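/- Let $\mathcal{A}$ be a finite discrete alphabet and let $X \subset \mathcal{A}^{\mathbb{Z}}$ be an infinite irreducible shift of finite type, with left shift $\sigma\colon X \to X$, $(\sigma x)_i = x_{i+1}$. That is, $X$ is the set of all bi-infinite sequences in which no word of some fixed finite set of words occurs, $X$ is infinite, and for all nonempty words $u, v$ occurring in points of $X$ there is a nonempty word $w$ occurring in a point of $X$ such that $uwv$ occurs in a point of $X$. Let $\operatorname{Homeo}(X)$ be the group of self-homeomorphisms of $X$ under composition, for $k \ge 1$ let $\operatorname{Aut}^{(k)}(\sigma)$ be the centralizer of $\sigma^k$ in $\operatorname{Homeo}(X)$, and let $$\operatorname{Aut}^{(\infty)}(\sigma) = \bigcup_{k=1}^{\infty} \operatorname{Aut}^{(k)}(\sigma) \subset \operatorname{Homeo}(X)$$ be the stabilized automorphism group. Then the center of $\operatorname{Aut}^{(\infty)}(\sigma)$ is trivial, and $\operatorname{Aut}^{(\infty)}(\sigma)$ is not finitely generated. -/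

import Mathlib

namespace SymbolicDynamics.FullShift

/-- The finite word `w` occurs in the bi-infinite sequence `x` starting at position `i`. -/
def WordOccursAt {A : Type*} (w : List A) (x : ℤ → A) (i : ℤ) : Prop :=
  ∀ (j : ℕ) (hj : j < w.length), x (i + j) = w[j]

namespace Subshift

variable {A : Type*} [TopologicalSpace A]

/-- The language of a subshift: the words `w = w₁ … wₙ` of length `n ≥ 1` whose cylinder set
`[w] = {x | xᵢ = wᵢ for i = 1, …, n}` meets the subshift. -/
def wordLanguage (X : Subshift A ℤ) : Set (List A) :=
  {w | w ≠ [] ∧ ∃ x ∈ X.carrier, WordOccursAt w x 1}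

/-- A subshift is of finite type if it consists of all bi-infinite sequences in which no word of
some finite set of words occurs. -/
def IsOfFiniteType (X : Subshift A ℤ) : Prop :=
  ∃ F : Set (List A), F.Finite ∧
    X.carrier = {x | ∀ w ∈ F, ∀ i : ℤ, ¬ WordOccursAt w x i}

/-- A subshift is irreducible if any two words of its language can be joined by a word of the
language to a word of the language. -/
def IsIrreducible (X : Subshift A ℤ) : Prop :=
  ∀ u ∈ X.wordLanguage, ∀ v ∈ X.wordLanguage, ∃ w ∈ X.wordLanguage,
    u ++ w ++ v ∈ X.wordLanguage

/-- The left shift `(σ x)ᵢ = xᵢ₊₁` as a homeomorphism of the subshift. -/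
def shiftHomeo (X : Subshift A ℤ) : X.carrier ≃ₜ X.carrier where
  toFun x := ⟨shift 1 x, X.mapsTo 1 x.2⟩
  invFun x := ⟨shift (-1) x, X.mapsTo (-1) x.2⟩
  left_inv x := by
    apply Subtype.ext
    funext i
    simp [shift]
  right_inv x := by
    apply Subtype.ext
    funext i
    simp [shift]
  continuous_toFun := ((continuous_shift 1).comp continuous_subtype_val).subtype_mk _
  continuous_invFun := ((continuous_shift (-1)).comp continuous_subtype_val).subtype_mk _

/-- The group `Aut⁽ᵏ⁾(σ)`: the centralizer of `σ ^ k` in the group of self-homeomorphisms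
(under composition) of the subshift. -/
def autPow (X : Subshift A ℤ) (k : ℕ) : Subgroup (X.carrier ≃ₜ X.carrier) :=
  Subgroup.centralizer {X.shiftHomeo ^ k}

theorem autPow_le_mul (X : Subshift A ℤ) (k m : ℕ) : X.autPow k ≤ X.autPow (k * m) := by
  intro f hf
  rw [autPow, Subgroup.mem_centralizer_singleton_iff] at hf ⊢
  rw [pow_mul]
  exact (Commute.pow_right (show Commute f (X.shiftHomeo ^ k) from hf) m)

/-- The stabilized automorphism group `Aut⁽∞⁾(σ) = ⋃_{k ≥ 1} Aut⁽ᵏ⁾(σ)`. -/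
def stabilizedAut (X : Subshift A ℤ) : Subgroup (X.carrier ≃ₜ X.carrier) where
  carrier := {f | ∃ k : ℕ, 1 ≤ k ∧ f ∈ X.autPow k}
  one_mem' := ⟨1, le_rfl, one_mem _⟩
  mul_mem' := by
    rintro f g ⟨k, hk, hf⟩ ⟨l, hl, hg⟩
    refine ⟨k * l, Nat.mul_pos hk hl, mul_mem (X.autPow_le_mul k l hf) ?_⟩
    rw [mul_comm k l]
    exact X.autPow_le_mul l k hg
  inv_mem' := by
    rintro f ⟨k, hk, hf⟩
    exact ⟨k, hk, inv_mem hf⟩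

end Subshift

end SymbolicDynamics.FullShift

/-!
Both assertions come from one construction. In a shift of finite type, two blocks of length `K`
that begin and end with the same long enough words may be exchanged wherever they occur at a
multiple of `K`; this gives an involution commuting with `σ ^ K` (`HasWindow.exists_swap`).

For the center, let `p ≠ q` be points with `σ ^ k p = p` and `σ ^ k q = q`. Since the shift is
infinite and irreducible, `q` can leave its orbit and come back to it in phase
(`exists_perturbation`), so for some multiple `K` of `k` there are at least two other blocks with
the same ends as the block of `q`, and one of these is not the block of `p`. Exchanging it with
the block of `q` fixes `p` and moves `q` (`exists_stabilizedAut_separating`). A central element `f`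
commutes with `σ`, so `f p` has the same period as `p`; were `f p ≠ p`, then with `q = f p` some
`g` would satisfy `f p = f (g p) = g (f p) ≠ f p`. Hence `f` fixes all periodic points, which are
dense (`dense_periodic`), and `f = 1`.

If the group is finitely generated, it is the centralizer of a single `σ ^ k`
(`exists_stabilizedAut_le_autPow`). Then `σ ^ k` is central, hence trivial, and the shift consists
of the finitely many sequences of period `k`.
-/

namespace SymbolicDynamics.FullShift

open Set

theorem wordOccursAt_append {A : Type*} {u v : List A} {x : ℤ → A} {i : ℤ} :
    WordOccursAt (u ++ v) x i ↔ WordOccursAt u x i ∧ WordOccursAt v x (i + u.length) := by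
  constructor
  · intro h
    refine ⟨fun j hj => ?_, fun j hj => ?_⟩
    · rw [h j (by simp; omega), List.getElem_append_left hj]
    · have := h (u.length + j) (by simp; omega)
      rw [List.getElem_append_right (by omega)] at this
      simpa [add_assoc] using this
  · rintro ⟨hu, hv⟩ j hj
    by_cases hju : j < u.length
    · rw [hu j hju, List.getElem_append_left hju]
    · have := hv (j - u.length) (by simp at hj; omega)
      rw [List.getElem_append_right (by omega), ← this]
      congr 1
      omega

namespace Subshift

section

variable {A : Type*} [TopologicalSpace A]

/-! ### Gluing and closing in a shift of finite type -/

/-- `N` is a window length for `X`: a sequence belongs to `X` as soon as each of its windows of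
length `N` is a window, at the same place, of some point of `X`. -/
def HasWindow (X : Subshift A ℤ) (N : ℕ) : Prop :=
  ∀ z : ℤ → A, (∀ i : ℤ, ∃ x ∈ X.carrier, EqOn z x (Ico i (i + N))) → z ∈ X.carrier

theorem IsOfFiniteType.exists_hasWindow {X : Subshift A ℤ} (h : X.IsOfFiniteType) :
    ∃ N : ℕ, 0 < N ∧ X.HasWindow N := by
  obtain ⟨F, hF, hX⟩ := h
  obtain ⟨M, hM⟩ := (hF.image List.length).bddAbove
  refine ⟨M + 1, M.succ_pos, fun z hz => ?_⟩
  rw [hX]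
  intro w hw i hocc
  obtain ⟨x, hx, hzx⟩ := hz i
  rw [hX] at hx
  have hlen : w.length ≤ M := hM (mem_image_of_mem _ hw)
  refine hx w hw i fun j hj => ?_
  rw [← hocc j hj]
  exact (hzx ⟨by omega, by push_cast; omega⟩).symm

variable {X : Subshift A ℤ} {N : ℕ}

/-- Two points that agree on a window can be glued along it. -/
theorem HasWindow.glue (hN : X.HasWindow N) {x y : ℤ → A} (hx : x ∈ X.carrier)
    (hy : y ∈ X.carrier) {a : ℤ} (hxy : EqOn x y (Ico a (a + N))) :
    (fun i => if i < a then x i else y i) ∈ X.carrier := by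
  refine hN _ fun i => ?_
  by_cases hi : i < a
  · refine ⟨x, hx, fun s hs => ?_⟩
    by_cases hs' : s < a
    · simp [hs']
    · simp only [hs', if_false]
      exact (hxy ⟨by omega, by have := hs.2; omega⟩).symm
  · refine ⟨y, hy, fun s hs => ?_⟩
    have : ¬ s < a := by have := hs.1; omega
    simp [this]

/-- A point in which a window recurs after `l` steps can be closed up to a point of period `l`. -/
theorem HasWindow.exists_periodic (hN : X.HasWindow N) {x : ℤ → A} (hx : x ∈ X.carrier)
    {a : ℤ} {l : ℕ} (hl : 0 < l) (hNl : N ≤ l)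
    (hxl : ∀ s ∈ Ico a (a + N), x (s + l) = x s) :
    ∃ y ∈ X.carrier, Function.Periodic y (l : ℤ) ∧ EqOn y x (Ico a (a + l)) := by
  have hl' : (0 : ℤ) < l := by exact_mod_cast hl
  refine ⟨fun i => x (a + (i - a) % l), hN _ fun i => ?_, fun i => ?_, fun i hi => ?_⟩
  · -- Shift `x` so that the window at `i` starts at its representative in `[a, a + l)`.
    have hmod := Int.emod_add_mul_ediv (i - a) l
    have h0 := Int.emod_nonneg (i - a) hl'.ne'
    have h1 := Int.emod_lt_of_pos (i - a) hl'
    set r := (i - a) % l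
    set n := (i - a) / l
    refine ⟨shift (-(l * n)) x, X.mapsTo _ hx, fun s hs => ?_⟩
    obtain ⟨d, rfl⟩ : ∃ d, s = i + d := ⟨s - i, by ring⟩
    have hd := hs.1
    have hd' := hs.2
    have e : i + d - a = (r + d) + l * n := by linarith
    have e' : -(l * n) + (i + d) = a + (r + d) := by linarith
    simp only [shift_apply, e, e', Int.add_mul_emod_self_left]
    by_cases hrd : r + d < l
    · rw [Int.emod_eq_of_lt (by omega) hrd]
    · rw [← Int.sub_emod_right, Int.emod_eq_of_lt (by omega) (by omega),
        ← hxl (a + (r + d - l)) ⟨by omega, by omega⟩]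
      congr 1
      ring
  · have : i + l - a = i - a + l := by ring
    simp only [this, Int.add_emod_right]
  · have h1 := hi.1
    have h2 := hi.2
    simp only
    rw [Int.emod_eq_of_lt (by omega) (by omega)]
    congr 1
    ring

/-- Irreducibility in terms of points: a window of one point can be followed, after a suitable
gap, by a window of another one. -/
theorem IsIrreducible.exists_join (hirr : X.IsIrreducible) {x y : ℤ → A} (hx : x ∈ X.carrier)
    (hy : y ∈ X.carrier) {a b c d : ℤ} (hab : a < b) (hcd : c < d) :
    ∃ z ∈ X.carrier, ∃ m : ℤ, b ≤ c + m ∧ EqOn z x (Ico a b) ∧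
      ∀ s ∈ Ico c d, z (s + m) = y s := by
  have key : ∀ {x : ℤ → A} {a b : ℤ}, x ∈ X.carrier → a < b →
      List.ofFn (fun t : Fin (b - a).toNat => x (a + t)) ∈ X.wordLanguage := by
    intro x a b hx hab
    refine ⟨?_, shift (a - 1) x, X.mapsTo _ hx, fun j hj => ?_⟩
    · rw [← List.length_pos_iff_ne_nil, List.length_ofFn]
      omega
    · simp only [List.getElem_ofFn, shift_apply]
      congr 1
      ring
  obtain ⟨w, -, -, z, hz, hocc⟩ := hirr _ (key hx hab) _ (key hy hcd)
  rw [wordOccursAt_append, wordOccursAt_append] at hocc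
  obtain ⟨⟨hu, -⟩, hv⟩ := hocc
  refine ⟨shift (1 - a) z, X.mapsTo _ hz, b + w.length - c, by omega, fun s hs => ?_,
    fun s hs => ?_⟩
  · have h1 := hs.1
    have h2 := hs.2
    have := hu (s - a).toNat (by simp; omega)
    simp only [List.getElem_ofFn] at this
    rw [shift_apply, show 1 - a + s = 1 + ((s - a).toNat : ℤ) by omega, this]
    congr 1
    omega
  · have h1 := hs.1
    have h2 := hs.2
    have := hv (s - c).toNat (by simp; omega)
    simp only [List.getElem_ofFn, List.length_append, List.length_ofFn] at this
    rw [shift_apply, show 1 - a + (s + (b + w.length - c)) =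
      1 + (((b - a).toNat + w.length : ℕ) : ℤ) + ((s - c).toNat : ℤ) by push_cast; omega, this]
    congr 1
    omega

/-- Every window of a point of an irreducible shift of finite type occurs in a periodic point. -/
theorem exists_periodic_eqOn (hN : X.HasWindow N) (hN0 : 0 < N) (hirr : X.IsIrreducible)
    {x : ℤ → A} (hx : x ∈ X.carrier) (M : ℕ) :
    ∃ y ∈ X.carrier, EqOn y x (Icc (-M) M) ∧ ∃ k : ℕ, 0 < k ∧ Function.Periodic y (k : ℤ) := by
  obtain ⟨z, hz, m, hm, hzx, hzx'⟩ := hirr.exists_join hx hx (a := -M) (b := M + N + 1) (c := -M)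
    (d := -M + N) (by omega) (by omega)
  lift m to ℕ using (by omega)
  obtain ⟨y, hy, hper, hyz⟩ := hN.exists_periodic hz (a := -M) (l := m) (by omega) (by omega)
    (fun s hs => by rw [hzx' s hs, hzx ⟨hs.1, by have := hs.2; omega⟩])
  refine ⟨y, hy, fun s hs => ?_, m, by omega, hper⟩
  have h1 := hs.1
  have h2 := hs.2
  rw [hyz ⟨h1, by omega⟩, hzx ⟨h1, by omega⟩]

/-! ### Perturbing a periodic point inside a block -/

/-- An infinite shift has a window that occurs nowhere in a given periodic point. -/
theorem exists_window_notMem_periodic (hinf : X.carrier.Infinite) {q : ℤ → A} {k : ℕ} (hk : 0 < k)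
    (hq : Function.Periodic q (k : ℤ)) :
    ∃ w ∈ X.carrier, ∃ M : ℕ, ∀ m : ℤ, ∃ s ∈ Icc (-M : ℤ) M, q (s + m) ≠ w s := by
  obtain ⟨w, hw, hw'⟩ := hinf.exists_notMem_finite
    (finite_range fun i : Fin k => shift (i : ℤ) q)
  have hdiff : ∀ i : Fin k, ∃ s : ℤ, q (i + s) ≠ w s := fun i => by
    by_contra! h
    exact hw' ⟨i, funext h⟩
  choose s hs using hdiff
  refine ⟨w, hw, Finset.univ.sup fun i => (s i).natAbs, fun m => ?_⟩
  have hk' : (0 : ℤ) < k := by exact_mod_cast hk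
  have h0 := Int.emod_nonneg m hk'.ne'
  have h1 := Int.emod_lt_of_pos m hk'
  let i : Fin k := ⟨(m % k).toNat, by omega⟩
  have hle := Finset.le_sup (f := fun i => (s i).natAbs) (Finset.mem_univ i)
  refine ⟨s i, ⟨by omega, by omega⟩, ?_⟩
  convert! hs i using 1
  have hm := Int.emod_add_mul_ediv m k
  have : s i + m = (i : ℤ) + s i + (m / k) * k := by
    simp only [i]
    rw [Int.toNat_of_nonneg h0]
    linarith
  rw [this, ← smul_eq_mul]
  exact hq.zsmul (m / k) _

/-- A periodic point of an infinite irreducible shift of finite type can be changed inside a single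
block whose length is a multiple of the period. -/
theorem exists_perturbation (hN : X.HasWindow N) (hN0 : 0 < N) (hirr : X.IsIrreducible)
    (hinf : X.carrier.Infinite) {q : ℤ → A} (hqX : q ∈ X.carrier) {k : ℕ} (hk : 0 < k)
    (hq : Function.Periodic q (k : ℤ)) :
    ∃ y ∈ X.carrier, ∃ l : ℕ, 0 < l ∧ N ≤ k * l ∧ (∀ s ∉ Ico (0 : ℤ) (k * l), y s = q s) ∧
      y ≠ q := by
  obtain ⟨w, hw, M, hwM⟩ := exists_window_notMem_periodic hinf hk hq
  obtain ⟨z₁, hz₁, m₁, hm₁, hz₁q, hz₁w⟩ := hirr.exists_join hqX hw (a := 0) (b := N) (c := -M)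
    (d := M + 1) (by omega) (by omega)
  obtain ⟨z, hz, m, hm, hzz₁, hzq⟩ := hirr.exists_join hz₁ hqX (a := 0) (b := M + 1 + m₁) (c := 0)
    (d := N) (by omega) (by omega)
  lift m to ℕ using (by omega)
  obtain ⟨c, hc, hcper, hcz⟩ := hN.exists_periodic hz (a := 0) (l := m) (by omega) (by omega)
    (fun s hs => by
      have h1 := hs.1
      have h2 := hs.2
      rw [hzq s ⟨h1, by omega⟩, hzz₁ ⟨h1, by omega⟩, hz₁q ⟨h1, by omega⟩])
  have hcw : ∀ s ∈ Icc (-M : ℤ) M, c (s + m₁) = w s := fun s hs => by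
    have h1 := hs.1
    have h2 := hs.2
    rw [hcz ⟨by omega, by omega⟩, hzz₁ ⟨by omega, by omega⟩, hz₁w s ⟨h1, by omega⟩]
  have hcq : EqOn c q (Ico 0 N) := fun s hs => by
    have h1 := hs.1
    have h2 := hs.2
    rw [hcz ⟨by omega, by omega⟩, hzz₁ ⟨by omega, by omega⟩, hz₁q ⟨h1, by omega⟩]
  have hmk : (m : ℤ) ≤ k * m := by exact_mod_cast Nat.le_mul_of_pos_left m hk
  -- Running through the cycle `k` times brings it back in phase with `q`.
  have hg := hN.glue hqX hc (a := 0) (fun s hs => (hcq (by simpa using hs)).symm)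
  have hq' : ∀ s, q (s + k * m) = q s := fun s => by
    have := (hq.nat_mul m) s
    rwa [mul_comm] at this
  have hc' : ∀ s, c (s + k * m) = c s := fun s => by
    simpa using (hcper.nat_mul k) s
  have hg' := hN.glue hg hqX (a := k * m) (fun s hs => by
    have h1 := hs.1
    have h2 := hs.2
    have h3 : ¬ s < 0 := by omega
    obtain ⟨t, rfl⟩ : ∃ t, s = t + k * m := ⟨s - k * m, by ring⟩
    simp only [h3, if_false]
    rw [hc', hq', hcq ⟨by omega, by omega⟩])
  refine ⟨_, hg', m, by omega, by zify; omega, fun s hs => ?_, fun heq => ?_⟩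
  · simp only [mem_Ico, not_and, not_lt] at hs
    by_cases h0 : s < 0
    · simp [h0]
    · simp [not_lt.2 (hs (by omega))]
  · obtain ⟨s, hs, hne⟩ := hwM m₁
    have h1 := hs.1
    have h2 := hs.2
    apply hne
    rw [← hcw s hs, ← congrFun heq (s + m₁)]
    have h3 : s + m₁ < k * m := by omega
    have h4 : ¬ s + m₁ < 0 := by omega
    simp [h3, h4]

end

/-! ### Automorphisms of a power of the shift given by permutations of blocks -/

variable {A : Type*}

/-- The `n`-th of the consecutive blocks of length `K` into which the grid `K ℤ` cuts `x`. -/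
def block (K : ℕ) (x : ℤ → A) (n : ℤ) : Fin K → A := fun t => x (K * n + t)

/-- Apply `π` to each block of length `K` of a sequence. -/
def blockMap (K : ℕ) [NeZero K] (π : (Fin K → A) → Fin K → A) (x : ℤ → A) : ℤ → A := fun i =>
  π (block K x (i / K)) ⟨(i % K).toNat, by
    have h : (0 : ℤ) < K := by exact_mod_cast NeZero.pos K
    have := Int.emod_lt_of_pos i h
    have := Int.emod_nonneg i h.ne'
    omega⟩

theorem block_shift {K : ℕ} (x : ℤ → A) (n : ℤ) :
    block K (shift (K : ℤ) x) n = block K x (n + 1) := by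
  funext t
  simp only [block, shift_apply]
  congr 1
  ring

theorem block_eq_of_periodic {x : ℤ → A} {K : ℕ} (hx : Function.Periodic x (K : ℤ)) (n : ℤ) :
    block K x n = block K x 0 := by
  funext t
  have := hx.zsmul n (t : ℤ)
  simp only [block, mul_zero, zero_add]
  rw [← this, smul_eq_mul, add_comm, mul_comm]

section

variable {K : ℕ} [NeZero K]

theorem block_blockMap (π : (Fin K → A) → Fin K → A) (x : ℤ → A) (n : ℤ) :
    block K (blockMap K π x) n = π (block K x n) := by
  funext t
  have h : (0 : ℤ) < K := by exact_mod_cast NeZero.pos K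
  have ht : (t : ℤ) < K := by exact_mod_cast t.2
  have h1 : ((K : ℤ) * n + t) / K = n := by
    rw [Int.mul_add_ediv_left _ _ h.ne', Int.ediv_eq_zero_of_lt (by omega) ht, add_zero]
  have h2 : ((K : ℤ) * n + t) % K = t := by
    rw [Int.mul_add_emod_self_left, Int.emod_eq_of_lt (by omega) ht]
  simp only [block, blockMap, h1, h2, Int.toNat_natCast]

theorem block_ext {x y : ℤ → A} (h : ∀ n, block K x n = block K y n) : x = y := by
  funext i
  have hK : (0 : ℤ) < K := by exact_mod_cast NeZero.pos K
  have h1 := Int.emod_lt_of_pos i hK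
  have h0 := Int.emod_nonneg i hK.ne'
  have := congrFun (h (i / K)) ⟨(i % K).toNat, by omega⟩
  simpa only [block, Int.toNat_of_nonneg h0, Int.mul_ediv_add_emod] using this

theorem blockMap_leftInverse {π ρ : (Fin K → A) → Fin K → A} (h : Function.LeftInverse π ρ) :
    Function.LeftInverse (blockMap K π) (blockMap K ρ) := fun x =>
  block_ext (K := K) fun n => by rw [block_blockMap, block_blockMap, h]

theorem blockMap_shift (π : (Fin K → A) → Fin K → A) (x : ℤ → A) :
    blockMap K π (shift (K : ℤ) x) = shift (K : ℤ) (blockMap K π x) :=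
  block_ext (K := K) fun n => by simp only [block_blockMap, block_shift]

variable [TopologicalSpace A] {X : Subshift A ℤ} {N : ℕ}

theorem continuous_blockMap [Finite A] [DiscreteTopology A] (π : (Fin K → A) → Fin K → A) :
    Continuous (blockMap K π) := by
  refine continuous_pi fun i => ?_
  have hb : Continuous fun x : ℤ → A => block K x (i / K) :=
    continuous_pi fun t => continuous_apply _
  exact (continuous_apply _).comp ((continuous_of_discreteTopology (f := π)).comp hb)

/-- A map that turns blocks of points of `X` into such blocks and does not change the first and
the last `N` letters of a block acts on `X`. -/
theorem HasWindow.blockMap_mem (hN : X.HasWindow N) (hNK : N ≤ K) {π : (Fin K → A) → Fin K → A}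
    (hfix : ∀ w (t : Fin K), (t : ℕ) < N ∨ K ≤ t + N → π w t = w t)
    (hπ : ∀ x ∈ X.carrier, ∃ y ∈ X.carrier, block K y 0 = π (block K x 0)) {x : ℤ → A}
    (hx : x ∈ X.carrier) : blockMap K π x ∈ X.carrier := by
  refine hN _ fun i => ?_
  have hK : (0 : ℤ) < K := by exact_mod_cast NeZero.pos K
  have hmod := Int.mul_ediv_add_emod i K
  have h1 := Int.emod_lt_of_pos i hK
  have h0 := Int.emod_nonneg i hK.ne'
  set n := i / K
  set r := i % K
  have hb : ∀ (z : ℤ → A) (m : ℤ) (t : ℕ) (ht : t < K), z (K * m + t) = block K z m ⟨t, ht⟩ :=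
    fun _ _ _ _ => rfl
  by_cases hr : r + N ≤ K
  · -- The window lies inside one block.
    obtain ⟨y, hy, hyx⟩ := hπ (shift (K * n) x) (X.mapsTo _ hx)
    refine ⟨shift (-(K * n)) y, X.mapsTo _ hy, fun s hs => ?_⟩
    have hs1 := hs.1
    have hs2 := hs.2
    obtain ⟨t, rfl⟩ : ∃ t : ℕ, s = K * n + t := ⟨(s - K * n).toNat, by omega⟩
    have hsh : block K (shift (K * n) x) 0 = block K x n := by
      funext t
      simp [block]
    have ht : t < K := by omega
    rw [hb (blockMap K π x) _ _ ht, block_blockMap, ← hsh, ← hyx]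
    simp [block]
  · -- The window meets two blocks, and stays within distance `N` of their common end.
    refine ⟨x, hx, fun s hs => ?_⟩
    have hs1 := hs.1
    have hs2 := hs.2
    by_cases hsK : s < K * n + K
    · obtain ⟨t, rfl⟩ : ∃ t : ℕ, s = K * n + t := ⟨(s - K * n).toNat, by omega⟩
      have ht : t < K := by omega
      rw [hb (blockMap K π x) _ _ ht, hb x _ _ ht, block_blockMap]
      exact hfix _ _ (Or.inr (by simp only; omega))
    · obtain ⟨t, rfl⟩ : ∃ t : ℕ, s = K * (n + 1) + t :=
        ⟨(s - K * (n + 1)).toNat, by rw [mul_add, mul_one]; omega⟩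
      rw [mul_add, mul_one] at hs1 hs2
      have ht : t < K := by omega
      rw [hb (blockMap K π x) _ _ ht, hb x _ _ ht, block_blockMap]
      exact hfix _ _ (Or.inl (by simp only; omega))

theorem shiftHomeo_pow_apply (k : ℕ) (x : X.carrier) :
    ((X.shiftHomeo ^ k) x : ℤ → A) = shift (k : ℤ) (x : ℤ → A) := by
  induction k generalizing x with
  | zero => simp
  | succ k ih =>
    rw [pow_succ, Homeomorph.mul_apply, ih]
    funext i
    simp only [shiftHomeo, Homeomorph.homeomorph_mk_coe, Equiv.coe_fn_mk, shift_apply]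
    push_cast
    ring_nf

/-- Two blocks of points of `X` with the same first and last `N` letters can be exchanged by an
automorphism of a power of the shift. -/
theorem HasWindow.exists_swap [Finite A] [DiscreteTopology A] [DecidableEq (Fin K → A)]
    (hN : X.HasWindow N) (hNK : N ≤ K) {y y' : ℤ → A} (hy : y ∈ X.carrier)
    (hy' : y' ∈ X.carrier) (hends : ∀ t : Fin K, (t : ℕ) < N ∨ K ≤ t + N → y t = y' t) :
    ∃ g ∈ X.autPow K, ∀ (x : X.carrier) (n : ℤ), block K (g x : ℤ → A) n =
      Equiv.swap (block K y 0) (block K y' 0) (block K x n) := by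
  set π : (Fin K → A) → Fin K → A := ⇑(Equiv.swap (block K y 0) (block K y' 0)) with hπ
  have hfix : ∀ w (t : Fin K), (t : ℕ) < N ∨ K ≤ t + N → π w t = w t := by
    intro w t ht
    rw [hπ, Equiv.swap_apply_def]
    split_ifs with h1 h2
    · simp [h1, block, hends t ht]
    · simp [h2, block, hends t ht]
    · rfl
  have hmem : ∀ x ∈ X.carrier, ∃ z ∈ X.carrier, block K z 0 = π (block K x 0) := by
    intro x hx
    rw [hπ, Equiv.swap_apply_def]
    split_ifs
    exacts [⟨y', hy', rfl⟩, ⟨y, hy, rfl⟩, ⟨x, hx, rfl⟩]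
  have hinv : Function.LeftInverse (blockMap K π) (blockMap K π) :=
    blockMap_leftInverse fun w => by simp [hπ]
  have hcont : Continuous fun x : X.carrier =>
      (⟨blockMap K π x, hN.blockMap_mem hNK hfix hmem x.2⟩ : X.carrier) :=
    ((continuous_blockMap π).comp continuous_subtype_val).subtype_mk _
  let g : X.carrier ≃ₜ X.carrier :=
    { toFun := fun x => ⟨blockMap K π x, hN.blockMap_mem hNK hfix hmem x.2⟩
      invFun := fun x => ⟨blockMap K π x, hN.blockMap_mem hNK hfix hmem x.2⟩
      left_inv := fun x => Subtype.ext (hinv x)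
      right_inv := fun x => Subtype.ext (hinv x)
      continuous_toFun := hcont
      continuous_invFun := hcont }
  have hg : ∀ x, (g x : ℤ → A) = blockMap K π x := fun _ => rfl
  refine ⟨g, ?_, fun x n => by rw [hg, block_blockMap]⟩
  rw [autPow, Subgroup.mem_centralizer_singleton_iff]
  refine Homeomorph.ext fun x => Subtype.ext ?_
  simp only [Homeomorph.mul_apply, hg, shiftHomeo_pow_apply, blockMap_shift]

end

variable [TopologicalSpace A] {X : Subshift A ℤ} {N : ℕ}

/-- Distinct periodic points are separated by the stabilized automorphism group: some element fixes
the one and moves the other. -/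
theorem exists_stabilizedAut_separating [Finite A] [DiscreteTopology A] (hN : X.HasWindow N)
    (hN0 : 0 < N) (hirr : X.IsIrreducible) (hinf : X.carrier.Infinite) {p q : X.carrier}
    (hpq : p ≠ q) {k : ℕ} (hk : 0 < k) (hp : Function.Periodic (p : ℤ → A) (k : ℤ))
    (hq : Function.Periodic (q : ℤ → A) (k : ℤ)) :
    ∃ g ∈ X.stabilizedAut, g p = p ∧ g q ≠ q := by
  classical
  obtain ⟨y, hy, l, hl, hNl, hyq, hne⟩ := exists_perturbation hN hN0 hirr hinf q.2 hk hq
  obtain ⟨s, hs⟩ := Function.ne_iff.1 hne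
  have hsl : s ∈ Ico (0 : ℤ) (k * l) := by
    by_contra h
    exact hs (hyq s h)
  set L := k * l with hL
  have hL0 : 0 < L := Nat.mul_pos hk hl
  have hLZ : (k * l : ℤ) = L := by rw [hL]; push_cast; ring
  rw [hLZ] at hsl hyq
  have hqL : Function.Periodic (q : ℤ → A) (L : ℤ) := by
    rw [← hLZ, mul_comm]
    exact hq.nat_mul l
  have hpL : Function.Periodic (p : ℤ → A) (L : ℤ) := by
    rw [← hLZ, mul_comm]
    exact hp.nat_mul l
  let K := 4 * L
  have hKZ : (K : ℤ) = 4 * L := by simp [K]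
  have : NeZero K := ⟨by omega⟩
  have hqK : Function.Periodic (q : ℤ → A) (K : ℤ) := by
    rw [hKZ]
    exact_mod_cast hqL.nat_mul 4
  have hpK : Function.Periodic (p : ℤ → A) (K : ℤ) := by
    rw [hKZ]
    exact_mod_cast hpL.nat_mul 4
  have hblock : ∀ {x z : ℤ → A} {t : ℤ}, 0 ≤ t → t < K → x t ≠ z t →
      block K x 0 ≠ block K z 0 := by
    intro x z t h0 h1 hxz h
    apply hxz
    have := congrFun h ⟨t.toNat, by omega⟩
    simpa [block, Int.toNat_of_nonneg h0] using this
  -- Perform the perturbation in the second or in the third quarter of a block of length `4 L`: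
  -- as `N ≤ L`, this leaves the ends of the block alone, and at most one result is a block of `p`.
  let u : ℕ → ℤ → A := fun j => shift (-(j * L : ℤ)) y
  have hu : ∀ j, u j ∈ X.carrier := fun j => X.mapsTo _ hy
  have hqj : ∀ (j : ℕ) (t : ℤ), (q : ℤ → A) (-(j * L) + t) = (q : ℤ → A) t := fun j t => by
    have := (hqL.nat_mul j) (-(j * L) + t)
    rw [← this, neg_add_eq_sub, sub_add_cancel]
  have huq : ∀ (j : ℕ) (t : ℤ), t ∉ Ico (j * L : ℤ) (j * L + L) → u j t = (q : ℤ → A) t := by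
    intro j t ht
    rw [← hqj j t]
    refine hyq _ fun h => ht ?_
    have h1 := h.1
    have h2 := h.2
    exact ⟨by linarith, by linarith⟩
  have hus : ∀ j : ℕ, u j (j * L + s) ≠ (q : ℤ → A) (j * L + s) := by
    intro j
    rw [← hqj j (j * L + s)]
    simpa [u] using hs
  obtain ⟨hs0, hs1⟩ := hsl
  obtain ⟨j, hj1, hj2, hjp⟩ : ∃ j : ℕ, 1 ≤ j ∧ j ≤ 2 ∧ block K (u j) 0 ≠ block K (p : ℤ → A) 0 := by
    by_contra! h
    have h12 := (h 1 le_rfl (by norm_num)).trans (h 2 (by norm_num) le_rfl).symm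
    have h1s := hus 1
    rw [← huq 2 _ (fun h => by have := h.1; push_cast at this; omega)] at h1s
    exact hblock (by push_cast; omega) (by push_cast; omega) h1s h12
  have hjL : (L : ℤ) ≤ j * L ∧ (j * L : ℤ) ≤ 2 * L := by
    constructor <;> nlinarith
  have hjq : block K (u j) 0 ≠ block K (q : ℤ → A) 0 :=
    hblock (by omega) (by omega) (hus j)
  have hpq' : block K (p : ℤ → A) 0 ≠ block K (q : ℤ → A) 0 := fun h =>
    hpq <| Subtype.ext <| block_ext (K := K) fun n => by
      rw [block_eq_of_periodic hpK, block_eq_of_periodic hqK, h]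
  obtain ⟨g, hg, hgb⟩ := hN.exists_swap (K := K) (by omega) q.2 (hu j) (fun t ht =>
    (huq j _ fun h => by
      have h1 := h.1
      have h2 := h.2
      omega).symm)
  refine ⟨g, ⟨K, NeZero.one_le, hg⟩, Subtype.ext ?_, fun h => hjq ?_⟩
  · refine block_ext (K := K) fun n => ?_
    rw [hgb, block_eq_of_periodic hpK, Equiv.swap_apply_of_ne_of_ne hpq' hjp.symm]
  · have := hgb q 0
    rw [Equiv.swap_apply_left, h] at this
    exact this.symm

/-! ### The center and finite generation -/

/-- Periodic points are dense in an irreducible shift of finite type. -/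
theorem dense_periodic [DiscreteTopology A] (hN : X.HasWindow N) (hN0 : 0 < N)
    (hirr : X.IsIrreducible) :
    Dense {x : X.carrier | ∃ k : ℕ, 0 < k ∧ Function.Periodic (x : ℤ → A) (k : ℤ)} := by
  rw [dense_iff_inter_open]
  rintro U hU ⟨x, hx⟩
  obtain ⟨V, hV, rfl⟩ := isOpen_induced_iff.1 hU
  obtain ⟨I, u, hu, hIV⟩ := isOpen_pi_iff.1 hV x hx
  obtain ⟨y, hy, hyx, hper⟩ := exists_periodic_eqOn hN hN0 hirr x.2 (I.sup Int.natAbs)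
  refine ⟨⟨y, hy⟩, hIV fun i hi => ?_, hper⟩
  have hle := Finset.le_sup (f := Int.natAbs) (Finset.mem_coe.1 hi)
  have hi' := (hu i hi).2
  rwa [← hyx ⟨by omega, by omega⟩] at hi'

theorem center_stabilizedAut_eq_bot [Finite A] [DiscreteTopology A] (hSFT : X.IsOfFiniteType)
    (hirr : X.IsIrreducible) (hinf : X.carrier.Infinite) :
    Subgroup.center X.stabilizedAut = ⊥ := by
  obtain ⟨N, hN0, hN⟩ := hSFT.exists_hasWindow
  rw [eq_bot_iff]
  rintro ⟨f, hf⟩ hcenter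
  rw [Subgroup.mem_center_iff] at hcenter
  have hcomm : ∀ g ∈ X.stabilizedAut, ∀ x, g (f x) = f (g x) := fun g hg x =>
    DFunLike.congr_fun (congrArg Subtype.val (hcenter ⟨g, hg⟩)) x
  rw [Subgroup.mem_bot, Subtype.ext_iff]
  refine DFunLike.coe_injective (Continuous.ext_on (dense_periodic hN hN0 hirr) f.continuous
    continuous_id ?_)
  rintro p ⟨k, hk, hp⟩
  by_contra hne
  have hσ : X.shiftHomeo ^ k ∈ X.stabilizedAut :=
    ⟨k, hk, Subgroup.mem_centralizer_singleton_iff.2 rfl⟩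
  have hiff : ∀ x : X.carrier, Function.Periodic (x : ℤ → A) (k : ℤ) ↔
      (X.shiftHomeo ^ k) x = x := fun x => by
    rw [Subtype.ext_iff, shiftHomeo_pow_apply, funext_iff]
    simp only [shift_apply, add_comm (k : ℤ), Function.Periodic]
  have hq : Function.Periodic (f p : ℤ → A) (k : ℤ) := by
    rw [hiff, hcomm _ hσ, (hiff p).1 hp]
  obtain ⟨g, hg, hgp, hgq⟩ :=
    exists_stabilizedAut_separating hN hN0 hirr hinf (Ne.symm hne) hk hp hq
  exact hgq ((hcomm g hg p).trans (congrArg f hgp))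

/-- A finitely generated stabilized automorphism group is the centralizer of one power of the
shift, because the groups `Aut⁽ᵏ⁾(σ)` are directed by divisibility. -/
theorem exists_stabilizedAut_le_autPow (hfg : Group.FG X.stabilizedAut) :
    ∃ k : ℕ, 0 < k ∧ X.stabilizedAut ≤ X.autPow k := by
  obtain ⟨S, hS⟩ := (Group.fg_iff_subgroup_fg _).1 hfg
  have hmem : ∀ s ∈ S, ∃ k : ℕ, 1 ≤ k ∧ s ∈ X.autPow k := fun s hs => by
    have : s ∈ X.stabilizedAut := hS ▸ Subgroup.subset_closure hs
    exact this
  choose! κ hκ1 hκ using hmem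
  refine ⟨∏ s ∈ S, κ s, Finset.prod_pos hκ1, ?_⟩
  rw [← hS, Subgroup.closure_le]
  intro s hs
  obtain ⟨m, hm⟩ := Finset.dvd_prod_of_mem κ hs
  rw [hm]
  exact X.autPow_le_mul _ _ (hκ s hs)

theorem not_fg_stabilizedAut [Finite A] [DiscreteTopology A] (hSFT : X.IsOfFiniteType)
    (hirr : X.IsIrreducible) (hinf : X.carrier.Infinite) : ¬ Group.FG X.stabilizedAut := by
  intro hfg
  obtain ⟨k, hk, hle⟩ := exists_stabilizedAut_le_autPow hfg
  have hσ : X.shiftHomeo ^ k ∈ X.stabilizedAut :=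
    ⟨k, hk, Subgroup.mem_centralizer_singleton_iff.2 rfl⟩
  have hc : (⟨X.shiftHomeo ^ k, hσ⟩ : X.stabilizedAut) ∈ Subgroup.center X.stabilizedAut :=
    Subgroup.mem_center_iff.2 fun g =>
      Subtype.ext (Subgroup.mem_centralizer_singleton_iff.1 (hle g.2))
  rw [center_stabilizedAut_eq_bot hSFT hirr hinf, Subgroup.mem_bot, Subtype.ext_iff] at hc
  have : NeZero k := ⟨hk.ne'⟩
  have hper : ∀ x ∈ X.carrier, Function.Periodic x (k : ℤ) := fun x hx i => by
    have := congrFun (congrArg Subtype.val (DFunLike.congr_fun hc ⟨x, hx⟩)) i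
    rw [shiftHomeo_pow_apply] at this
    rwa [add_comm]
  -- A sequence of period `k` is determined by one block of length `k`.
  refine hinf (Set.Finite.of_injOn (f := fun x => block k x 0) (t := univ) (fun _ _ => mem_univ _)
    (fun x hx y hy hxy => block_ext (K := k) fun n => ?_) finite_univ)
  rw [block_eq_of_periodic (hper x hx), block_eq_of_periodic (hper y hy)]
  exact hxy

end Subshift
end SymbolicDynamics.FullShift

theorem mainTheorem8 {A : Type*} [Finite A] [TopologicalSpace A] [DiscreteTopology A]
    (X : SymbolicDynamics.FullShift.Subshift A ℤ)
    (hSFT : X.IsOfFiniteType) (hirr : X.IsIrreducible) (hinf : X.carrier.Infinite) :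
    Subgroup.center X.stabilizedAut = ⊥ ∧ ¬ Group.FG X.stabilizedAut :=
  ⟨SymbolicDynamics.FullShift.Subshift.center_stabilizedAut_eq_bot hSFT hirr hinf,
    SymbolicDynamics.FullShift.Subshift.not_fg_stabilizedAut hSFT hirr hinf⟩
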